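/- Let $d, D \ge 1$ be integers. For $k\ge 1$ let $P_k^+$ be the space of symmetric positive-definite real $k\times k$ matrices (with the topology induced from $\mathbb{R}^{k\times k}$) and let $\mathrm{Sym}_k$ be the vector space of symmetric real $k\times k$ matrices, which has dimension $k(k+1)/2$. For $A, C\in P_k^+$ and $V\in \mathrm{Sym}_k$ put $$\operatorname{Log}_A(C)=\sqrt{A}\,\log\!\big(\sqrt{A}^{-1}C\sqrt{A}^{-1}\big)\sqrt{A}\in \mathrm{Sym}_k,\qquad \operatorname{Exp}_A(V)=\sqrt{A}\,\exp\!\big(\sqrt{A}^{-1}V\sqrt{A}^{-1}\big)\sqrt{A}\in P_k^+,$$ where $\exp,\log$ are the matrix exponential and logarithm and $\sqrt{A}$ is the positive square root, and let $$d_+(A,C)=\big\|\log\!\big(\sqrt{A}^{-1}C\sqrt{A}^{-1}\big)\big\|_F$$ be the affine-invariant Riemannian distance on $P_k^+$ ($\|\cdot\|_F$ is the Frobenius norm). A set $S\subseteq C(X,Y)$ of continuous maps is called ucc-dense with respect to a distance $\delta$ on $Y$ if for every $g\in C(X,Y)$, every compact $K\subseteq X$ and every $\varepsilon>0$ there is $h\in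 S$ with $\delta(g(x),h(x))<\varepsilon$ for all $x\in K$; on Euclidean spaces $\delta$ is the Euclidean distance. Fix arbitrary linear isomorphisms $a:\mathrm{Sym}_d\to\mathbb{R}^{d(d+1)/2}$ and $b:\mathrm{Sym}_D\to\mathbb{R}^{D(D+1)/2}$, and let $A\in P_d^+$, $B\in P_D^+$. For $\mathcal F\subseteq C(\mathbb{R}^{d(d+1)/2},\mathbb{R}^{D(D+1)/2})$ let $$\mathcal F_{\operatorname{Log}_A,\operatorname{Exp}_B}=\big\{g\in C(P_d^+,P_D^+):\ g=\operatorname{Exp}_B\circ\, b^{-1}\circ f\circ a\circ\operatorname{Log}_A\ \text{ for some } f\in\mathcal F\big\}.$$ 1. If $\mathcal F$ is ucc-dense in $C(\mathbb{R}^{d(d+1)/2},\mathbb{R}^{D(D+1)/2})$, then $\mathcal F_{\operatorname{Log}_A,\operatorname{Exp}_B}$ is ucc-dense in $C(P_d^+,P_D^+)$ with respect to $d_+$, and it is dense in $C(P_d^+,P_D^+)$ for the compact-open topology. 2. In particular, let $\sigma:\mathbb{R}\to\mathbb{R}$ be continuous (hence locally bounded) and not equal to a polynomial function. A feed-forward network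 with $J$ hidden layers is a map $W\circ\sigma\bullet W^{(J)}\circ\cdots\circ\sigma\bullet W^{(1)}$, where $W,W^{(1)},\dots,W^{(J)}$ are affine maps between Euclidean spaces (of arbitrary intermediate dimensions) and $\sigma\bullet$ denotes component-wise application of $\sigma$. Then both conclusions of 1 hold when $\mathcal F$ is the set of networks from $\mathbb{R}^{d(d+1)/2}$ to $\mathbb{R}^{D(D+1)/2}$ with exactly one hidden layer, and also when $\mathcal F$ is the set $\mathcal{NN}$ of all such networks with any number $J\ge1$ of hidden layers. -/

import Mathlib

/-- The Euclidean space `ℝⁿ`. -/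
abbrev Euc (n : ℕ) : Type := EuclideanSpace ℝ (Fin n)

/-- The space `P_d⁺` of symmetric positive-definite `d × d` real matrices, with the topology
induced by the space of all matrices. -/
abbrev SPD (d : ℕ) : Type := {A : Matrix (Fin d) (Fin d) ℝ // A.PosDef}

/-- The real vector space of symmetric `d × d` matrices: the tangent space of `P_d⁺` at any
of its points. -/
def SymMat (d : ℕ) : Submodule ℝ (Matrix (Fin d) (Fin d) ℝ) where
  carrier := {M | M.IsSymm}
  add_mem' := fun h₁ h₂ => h₁.add h₂
  zero_mem' := Matrix.transpose_zero
  smul_mem' := fun c _ h => h.smul c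

/-- Symmetric matrices are the functions on unordered pairs of indices. -/
def SymMat.equivSym2 (d : ℕ) : SymMat d ≃ₗ[ℝ] (Sym2 (Fin d) → ℝ) where
  toFun M s := Sym2.lift ⟨fun i j => M.1 i j, fun i j => M.2.apply j i⟩ s
  invFun f := ⟨Matrix.of fun i j => f s(i, j), by
    ext i j; simp [Matrix.transpose_apply, Sym2.eq_swap]⟩
  left_inv M := by ext i j; simp
  right_inv f := by
    ext s; induction s using Sym2.ind with | _ i j => simp
  map_add' M N := by
    ext s; induction s using Sym2.ind with | _ i j => simp
  map_smul' c M := by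
    ext s; induction s using Sym2.ind with | _ i j => simp

/-- The space of symmetric `d × d` matrices can be identified with `ℝ^(d(d+1)/2)`. -/
theorem SymMat.nonempty_equiv (d : ℕ) :
    Nonempty (SymMat d ≃ₗ[ℝ] Euc (d * (d + 1) / 2)) := by
  have : FiniteDimensional ℝ (SymMat d) := inferInstance
  refine ⟨LinearEquiv.ofFinrankEq _ _ ?_⟩
  rw [(SymMat.equivSym2 d).finrank_eq, Module.finrank_fintype_fun_eq_card, Sym2.card,
    finrank_euclideanSpace_fin, Fintype.card_fin, Nat.choose_two_right, Nat.add_sub_cancel,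
    Nat.mul_comm]

/-- The positive square root `√A` of a positive-definite matrix. -/
noncomputable def spdSqrt {d : ℕ} (A : SPD d) : Matrix (Fin d) (Fin d) ℝ :=
  open scoped MatrixOrder in CFC.sqrt A.1

theorem spdSqrt_posDef {d : ℕ} (A : SPD d) : (spdSqrt A).PosDef := by
  open scoped MatrixOrder in
  have h0 : (spdSqrt A).PosSemidef := Matrix.nonneg_iff_posSemidef.1 (CFC.sqrt_nonneg A.1)
  refine h0.posDef_iff_isUnit.2 ?_
  have hsq : spdSqrt A * spdSqrt A = A.1 := CFC.sqrt_mul_sqrt_self A.1 A.2.posSemidef.nonneg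
  have hu : IsUnit (spdSqrt A * spdSqrt A) := hsq ▸ A.2.isUnit
  rw [Matrix.isUnit_iff_isUnit_det] at hu ⊢
  rw [Matrix.det_mul] at hu
  exact isUnit_of_mul_isUnit_left hu

theorem posDef_exp {d : ℕ} {M : Matrix (Fin d) (Fin d) ℝ} (hM : M.IsHermitian) :
    (NormedSpace.exp M).PosDef := by
  have hN : ((2⁻¹ : ℝ) • M).IsHermitian := by
    unfold Matrix.IsHermitian
    rw [Matrix.conjTranspose_smul, hM.eq, star_trivial]
  have h : NormedSpace.exp M
      = NormedSpace.exp ((2⁻¹ : ℝ) • M) * (NormedSpace.exp ((2⁻¹ : ℝ) • M)).conjTranspose := by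
    rw [hN.exp.eq, ← Matrix.exp_add_of_commute _ _ (Commute.refl _), ← add_smul]
    norm_num
  rw [h]
  exact (Matrix.posSemidef_self_mul_conjTranspose _).posDef_iff_isUnit.2
    ((Matrix.isUnit_exp _).mul (hN.exp.eq.symm ▸ Matrix.isUnit_exp _))

/-- `log(√A⁻¹ C √A⁻¹)`, where `log` is the matrix logarithm, i.e. the real logarithm applied to
the eigenvalues of a symmetric positive-definite matrix. -/
noncomputable def relLog {d : ℕ} (A C : SPD d) : Matrix (Fin d) (Fin d) ℝ :=
  cfc Real.log ((spdSqrt A)⁻¹ * C.1 * (spdSqrt A)⁻¹)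

theorem relLog_isHermitian {d : ℕ} (A C : SPD d) : (relLog A C).IsHermitian :=
  cfc_predicate Real.log ((spdSqrt A)⁻¹ * C.1 * (spdSqrt A)⁻¹)

/-- The Riemannian logarithm of `P_d⁺` at `A`:
`Log_A(C) = √A log(√A⁻¹ C √A⁻¹) √A`, a symmetric matrix. -/
noncomputable def spdLog {d : ℕ} (A C : SPD d) : SymMat d :=
  ⟨spdSqrt A * relLog A C * spdSqrt A, by
    have h := Matrix.isHermitian_mul_mul_conjTranspose (spdSqrt A) (relLog_isHermitian A C)
    rw [(spdSqrt_posDef A).1.eq] at h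
    exact (Matrix.conjTranspose_eq_transpose_of_trivial _).symm.trans h⟩

/-- The Riemannian exponential of `P_d⁺` at `B`:
`Exp_B(V) = √B exp(√B⁻¹ V √B⁻¹) √B` for a symmetric matrix `V`. -/
noncomputable def spdExp {d : ℕ} (B : SPD d) (V : SymMat d) : SPD d :=
  ⟨spdSqrt B * NormedSpace.exp ((spdSqrt B)⁻¹ * V.1 * (spdSqrt B)⁻¹) * spdSqrt B, by
    have hS := spdSqrt_posDef B
    have hV : V.1.IsHermitian := (Matrix.conjTranspose_eq_transpose_of_trivial _).trans V.2
    have h := Matrix.isHermitian_mul_mul_conjTranspose (spdSqrt B)⁻¹ hV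
    rw [hS.inv.1.eq] at h
    have h2 := (Matrix.IsUnit.posDef_star_right_conjugate_iff hS.isUnit).2 (posDef_exp h)
    rwa [Matrix.star_eq_conjTranspose, hS.1.eq] at h2⟩

/-- The affine-invariant Riemannian distance on `P_d⁺`:
`d₊(A, C) = ‖log(√A⁻¹ C √A⁻¹)‖_F`, with `‖·‖_F` the Frobenius norm. -/
noncomputable def spdDist {d : ℕ} (A C : SPD d) : ℝ :=
  Real.sqrt (∑ i, ∑ j, relLog A C i j ^ 2)

/-- Density of `S ⊆ C(X, Y)` for uniform convergence on compacts, closeness in `Y` being measured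
by the distance function `δ`. -/
def UccDense {X Y : Type*} [TopologicalSpace X] [TopologicalSpace Y] (δ : Y → Y → ℝ)
    (S : Set C(X, Y)) : Prop :=
  ∀ g : C(X, Y), ∀ K : Set X, IsCompact K → ∀ ε : ℝ, 0 < ε →
    ∃ h ∈ S, ∀ x ∈ K, δ (g x) (h x) < ε

/-- The architecture obtained from `F ⊆ C(E, E')` with a feature map `φ : X → E` and a readout map
`ρ : E' → Y`: the continuous maps `X → Y` of the form `ρ ∘ f ∘ φ` with `f ∈ F`. -/
def liftArch {X E E' Y : Type*} [TopologicalSpace X] [TopologicalSpace E] [TopologicalSpace E']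
    [TopologicalSpace Y] (φ : X → E) (ρ : E' → Y) (F : Set C(E, E')) : Set C(X, Y) :=
  {g | ∃ f ∈ F, ∀ x, g x = ρ (f (φ x))}

/-- The architecture on positive-definite matrices made of the continuous maps
`Exp_B ∘ f ∘ Log_A` with `f ∈ F`, the spaces of symmetric matrices being identified with Euclidean
spaces by the linear isomorphisms `a` and `b`. -/
def spdArch {d D : ℕ} (a : SymMat d ≃ₗ[ℝ] Euc (d * (d + 1) / 2))
    (b : SymMat D ≃ₗ[ℝ] Euc (D * (D + 1) / 2)) (A : SPD d) (B : SPD D)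
    (F : Set C(Euc (d * (d + 1) / 2), Euc (D * (D + 1) / 2))) : Set C(SPD d, SPD D) :=
  liftArch (fun C => a (spdLog A C)) (fun v => spdExp B (b.symm v)) F

/-- Component-wise application of the activation function `σ`. -/
def compwise (σ : ℝ → ℝ) {n : ℕ} (x : Euc n) : Euc n :=
  WithLp.toLp 2 fun i => σ (x i)

/-- `IsFeedForward σ J f`: the map `f` is a feed-forward network with `J` hidden layers (of
arbitrary widths) and activation function `σ`, i.e.
`f = W ∘ (σ • W⁽ᴶ⁾) ∘ ⋯ ∘ (σ • W⁽¹⁾)` with affine maps `W, W⁽¹⁾, …, W⁽ᴶ⁾`. -/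
def IsFeedForward (σ : ℝ → ℝ) : ℕ → ∀ {m n : ℕ}, (Euc m → Euc n) → Prop
  | 0, m, n, f => ∃ W : Euc m →ᵃ[ℝ] Euc n, f = W
  | J + 1, m, n, f => ∃ (k : ℕ) (W : Euc m →ᵃ[ℝ] Euc k) (g : Euc k → Euc n),
      IsFeedForward σ J g ∧ f = fun x => g (compwise σ (W x))

/-- Networks with exactly `J` hidden layers, as a subset of `C(ℝᵐ, ℝⁿ)`. -/
def NNDepth (σ : ℝ → ℝ) (J m n : ℕ) : Set C(Euc m, Euc n) :=
  {f | IsFeedForward σ J f}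

/-- Networks with any number `J ≥ 1` of hidden layers. -/
def NN (σ : ℝ → ℝ) (m n : ℕ) : Set C(Euc m, Euc n) :=
  {f | ∃ J : ℕ, 1 ≤ J ∧ IsFeedForward σ J f}

/-! Since `Exp_A ∘ Log_A = id` with both maps continuous, `f ↦ Exp_B ∘ b⁻¹ ∘ f ∘ a ∘ Log_A` is a
continuous surjection of compact-open function spaces, so it sends dense sets to dense sets. As `d₊`
is continuous and vanishes on the diagonal, compact-open density gives ucc-density for `d₊`.

For networks, let `M` be a closed space of functions on a compact set containing every `σ(w + c)`,
`w` in a point-separating space `V`. Differentiating along `p ∈ V` would bring out a factor `p` but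
needs smoothness; instead, integrating a ridge function over shifts and then differentiating the
integral gives `p` times a forward difference (`mul_fwdDiff_mem`). Iteration yields `q · Δ_h^k σ(w +
c) ∈ M` for every product `q` of `k` elements of `V`. By Fréchet's theorem some `Δ_h^k σ(c)` is
nonzero, so `w = 0` gives `q ∈ M`, and Stone–Weierstrass concludes. -/

/-! ### Fréchet's theorem on vanishing differences -/

theorem exists_polynomial_eval_natCast_eq_choose (j : ℕ) :
    ∃ p : Polynomial ℝ, ∀ n : ℕ, p.eval (n : ℝ) = n.choose j := by
  refine ⟨Polynomial.C ((j.factorial : ℝ)⁻¹) * descPochhammer ℝ j, fun n => ?_⟩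
  rw [Polynomial.eval_mul, Polynomial.eval_C, descPochhammer_eval_eq_descFactorial,
    Nat.descFactorial_eq_factorial_mul_choose, Nat.cast_mul,
    inv_mul_cancel_left₀ (by exact_mod_cast j.factorial_ne_zero)]

/-- A function whose `k`-th forward difference of step `h` vanishes agrees with a polynomial on
every progression of step `h`. -/
theorem exists_polynomial_eval_progression {σ : ℝ → ℝ} {k : ℕ} {h : ℝ} (hh : h ≠ 0)
    (hσ : ∀ c, (fwdDiff h)^[k] σ c = 0) (y : ℝ) :
    ∃ p : Polynomial ℝ, ∀ n : ℕ, p.eval (y + n * h) = σ (y + n * h) := by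
  choose b hb using exists_polynomial_eval_natCast_eq_choose
  have hz : ∀ j, k ≤ j → (fwdDiff h)^[j] σ y = 0 := by
    intro j hj
    obtain ⟨i, rfl⟩ := Nat.exists_eq_add_of_le' hj
    rw [Function.iterate_add_apply, show (fwdDiff h)^[k] σ = fun _ => 0 from funext hσ]
    have h0 : ∀ i : ℕ, (fwdDiff h)^[i] (fun _ : ℝ => (0 : ℝ)) = fun _ => 0 := by
      intro i
      induction i with
      | zero => rfl
      | succ i ih => rw [Function.iterate_succ_apply', ih, fwdDiff_const]
    rw [h0]
  -- Newton's forward-difference series in the variable `(x - y) / h`, truncated at order `k`.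
  refine ⟨(∑ j ∈ Finset.range k, Polynomial.C ((fwdDiff h)^[j] σ y) * b j).comp
    (Polynomial.C h⁻¹ * (Polynomial.X - Polynomial.C y)), fun n => ?_⟩
  have hn : σ (y + n * h) = ∑ j ∈ Finset.range (n + 1), n.choose j * (fwdDiff h)^[j] σ y := by
    have := shift_eq_sum_fwdDiff_iter h σ n y
    simpa only [nsmul_eq_mul] using this
  have hx : (Polynomial.C h⁻¹ * (Polynomial.X - Polynomial.C y)).eval (y + n * h) = (n : ℝ) := by
    simp only [Polynomial.eval_mul, Polynomial.eval_C, Polynomial.eval_sub, Polynomial.eval_X]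
    field_simp
    ring
  rw [Polynomial.eval_comp, hx, Polynomial.eval_finsetSum, hn]
  simp only [Polynomial.eval_mul, Polynomial.eval_C, hb]
  -- Both sums extend to `max k (n + 1)`: the differences vanish from order `k` on, the binomials
  -- beyond `n`.
  rw [Finset.sum_subset (Finset.range_mono (le_max_left k (n + 1))),
    Finset.sum_subset (Finset.range_mono (le_max_right k (n + 1)))]
  · exact Finset.sum_congr rfl fun j _ => mul_comm _ _
  · intro j _ hj
    rw [Nat.choose_eq_zero_of_lt (by simpa using hj), Nat.cast_zero, zero_mul]
  · intro j _ hj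
    rw [hz j (by simpa using hj), zero_mul]

/-- Fréchet's characterization of polynomials: a continuous function on `ℝ` all of whose `k`-th
forward differences vanish is a polynomial. -/
theorem Continuous.exists_polynomial_of_fwdDiff_iter_eq_zero {σ : ℝ → ℝ} (hc : Continuous σ)
    {k : ℕ} (hσ : ∀ h c, (fwdDiff h)^[k] σ c = 0) :
    ∃ p : Polynomial ℝ, ∀ x, σ x = p.eval x := by
  obtain ⟨p, hp⟩ := exists_polynomial_eval_progression one_ne_zero (hσ 1) 0
  refine ⟨p, fun x => congrFun (hc.ext_on Rat.denseRange_cast p.continuous ?_) x⟩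
  rintro _ ⟨r, rfl⟩
  -- The progression from `-N` with step `1 / r.den` contains `r` and all naturals; agreement on the
  -- naturals forces its polynomial to be `p`.
  obtain ⟨N, hN⟩ := exists_nat_ge (-(r : ℝ))
  have hden : (r.den : ℝ) ≠ 0 := by exact_mod_cast r.den_nz
  have hden0 : (0 : ℝ) < r.den := by exact_mod_cast r.den_pos
  obtain ⟨q, hq⟩ := exists_polynomial_eval_progression (inv_ne_zero hden)
    (hσ (r.den : ℝ)⁻¹) (-(N : ℝ))
  have hpq : q = p := by
    refine Polynomial.eq_of_infinite_eval_eq q p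
      (Set.infinite_of_injective_forall_mem (f := fun n : ℕ => (n : ℝ)) Nat.cast_injective ?_)
    intro n
    have h1 := hq ((N + n) * r.den)
    have h2 := hp n
    have h3 : -(N : ℝ) + ((N + n) * r.den : ℕ) * (r.den : ℝ)⁻¹ = n := by
      push_cast
      field_simp
      ring
    rw [h3] at h1
    rw [zero_add, mul_one] at h2
    exact h1.trans h2.symm
  have hr : (r : ℝ) = r.num / r.den := Rat.cast_def r
  have hnum : 0 ≤ (N : ℤ) * r.den + r.num := by
    have h4 : (0 : ℝ) ≤ N * r.den + r.num := by
      have h5 : 0 ≤ ((N : ℝ) + r) * r.den := mul_nonneg (by linarith) hden0.le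
      rwa [add_mul, hr, div_mul_cancel₀ _ hden] at h5
    exact_mod_cast h4
  obtain ⟨n, hn⟩ := Int.eq_ofNat_of_zero_le hnum
  have h1 := hq n
  have h3 : -(N : ℝ) + n * (r.den : ℝ)⁻¹ = r := by
    have h6 : (n : ℝ) = N * r.den + r.num := by exact_mod_cast hn.symm
    rw [h6, hr]
    field_simp
    ring
  rw [h3, hpq] at h1
  exact h1.symm

/-! ### Closed spaces of ridge functions -/

theorem Submodule.intervalIntegral_mem {E : Type*} [NormedAddCommGroup E] [NormedSpace ℝ E]
    [CompleteSpace E] {M : Submodule ℝ E} (hM : IsClosed (M : Set E)) {γ : ℝ → E}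
    (hγ : Continuous γ) (hγM : ∀ s, γ s ∈ M) (a b : ℝ) : ∫ s in a..b, γ s ∈ M := by
  have : CompleteSpace M := hM.completeSpace_coe
  have hγ' : Continuous fun s => (⟨γ s, hγM s⟩ : M) := hγ.subtype_mk _
  rw [show ∫ s in a..b, γ s = M.subtypeL (∫ s in a..b, (⟨γ s, hγM s⟩ : M)) from
    M.subtypeL.intervalIntegral_comp_comm (hγ'.intervalIntegrable a b)]
  exact Subtype.property _

theorem ContinuousMap.intervalIntegral_apply {K : Type*} [TopologicalSpace K] [CompactSpace K]
    {γ : ℝ → C(K, ℝ)} (hγ : Continuous γ) (a b : ℝ) (x : K) :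
    (∫ s in a..b, γ s) x = ∫ s in a..b, γ s x :=
  ((ContinuousMap.evalCLM ℝ x).intervalIntegral_comp_comm (hγ.intervalIntegrable a b)).symm

/-- With `U` a primitive of `u`, both sides equal `U(y + sp + h) - U(y + h) - U(y + sp) + U(y)`.
Keeping the factor `p` on the left covers `p = 0`. -/
theorem integral_mul_sub_shift {u : ℝ → ℝ} (hu : Continuous u) (y p s h : ℝ) :
    ∫ t in (0 : ℝ)..s, p * (u (y + t * p + h) - u (y + t * p)) =
      ∫ r in (0 : ℝ)..h, (u (y + s * p + r) - u (y + r)) := by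
  have hi : ∀ a b, IntervalIntegrable u MeasureTheory.volume a b := fun a b =>
    hu.intervalIntegrable a b
  have h1 : ∀ z, p * ∫ t in (0 : ℝ)..s, u (z + p * t) = ∫ t in z..z + p * s, u t := fun z => by
    simp
  have h2 : ∀ z, ∫ r in (0 : ℝ)..h, u (z + r) = ∫ r in z..z + h, u r := fun z => by
    simp
  have e1 : ∫ t in (0 : ℝ)..s, p * (u (y + t * p + h) - u (y + t * p)) =
      p * (∫ t in (0 : ℝ)..s, u (y + h + p * t)) - p * ∫ t in (0 : ℝ)..s, u (y + p * t) := by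
    rw [intervalIntegral.integral_const_mul, ← mul_sub, ← intervalIntegral.integral_sub]
    · congr 2 with t
      congr 2 <;> ring
    all_goals exact Continuous.intervalIntegrable (by fun_prop) _ _
  rw [e1, h1, h1, intervalIntegral.integral_sub, h2, h2]
  · rw [← intervalIntegral.integral_interval_sub_left (hi 0 (y + h + p * s)) (hi 0 (y + h)),
      ← intervalIntegral.integral_interval_sub_left (hi 0 (y + p * s)) (hi 0 y),
      ← intervalIntegral.integral_interval_sub_left (hi 0 (y + s * p + h)) (hi 0 (y + s * p)),
      ← intervalIntegral.integral_interval_sub_left (hi 0 (y + h)) (hi 0 y)]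
    rw [show y + h + p * s = y + s * p + h by ring, mul_comm p s]
    ring
  all_goals exact Continuous.intervalIntegrable (by fun_prop) _ _

/-- The value `γ 0` is the limit of the slopes at `0` of the primitive, and these lie in `M`. -/
theorem Submodule.mem_of_forall_integral_mem {E : Type*} [NormedAddCommGroup E] [NormedSpace ℝ E]
    [CompleteSpace E] {M : Submodule ℝ E} (hM : IsClosed (M : Set E)) {γ : ℝ → E}
    (hγ : Continuous γ) (hγM : ∀ s, ∫ t in (0 : ℝ)..s, γ t ∈ M) : γ 0 ∈ M := by
  have hd := (hγ.integral_hasStrictDerivAt 0 0).hasDerivAt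
  rw [hasDerivAt_iff_tendsto_slope] at hd
  refine hM.mem_of_tendsto hd (Filter.Eventually.of_forall fun s => ?_)
  rw [slope_def_module]
  exact M.smul_mem _ (M.sub_mem (hγM s) (hγM 0))

section RidgeFunctions

variable {K : Type*} [TopologicalSpace K] [CompactSpace K]

/-- A closed space of functions containing the ridge functions `q * u(y + s p + r)` contains the
product of `q * p` with the forward differences of `u` along `y`. -/
theorem mul_fwdDiff_mem {M : Submodule ℝ C(K, ℝ)} (hM : IsClosed (M : Set C(K, ℝ)))
    (q p y : C(K, ℝ)) (u : C(ℝ, ℝ))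
    (hu : ∀ s r : ℝ, q * u.comp (y + s • p + ContinuousMap.const K r) ∈ M) (h : ℝ) :
    p * q * (u.comp (y + ContinuousMap.const K h) - u.comp y) ∈ M := by
  obtain ⟨τ, hτ⟩ : ∃ τ : ℝ → ℝ → C(K, ℝ),
      ∀ s r, τ s r = q * u.comp (y + s • p + ContinuousMap.const K r) := ⟨_, fun _ _ => rfl⟩
  simp only [← hτ] at hu
  have hτc : ∀ {f g : ℝ → ℝ}, Continuous f → Continuous g →
      Continuous fun t => τ (f t) (g t) := by
    intro f g hf hg
    simp only [hτ]
    have hg' : Continuous fun t => ContinuousMap.const K (g t) :=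
      ContinuousMap.continuous_const'.comp hg
    exact continuous_const.mul ((ContinuousMap.continuous_postcomp u).comp
      ((continuous_const.add (hf.smul continuous_const)).add hg'))
  have hγ : Continuous fun s => p * (τ s h - τ s 0) := continuous_const.mul
    ((hτc continuous_id continuous_const).sub (hτc continuous_id continuous_const))
  have hδ : ∀ s, Continuous fun r => τ s r - τ 0 r := fun s =>
    (hτc continuous_const continuous_id).sub (hτc continuous_const continuous_id)
  have hint : ∀ s, ∫ t in (0 : ℝ)..s, p * (τ t h - τ t 0) =
      ∫ r in (0 : ℝ)..h, (τ s r - τ 0 r) := by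
    intro s
    ext x
    rw [ContinuousMap.intervalIntegral_apply hγ, ContinuousMap.intervalIntegral_apply (hδ s)]
    have e := congrArg (q x * ·) (integral_mul_sub_shift u.continuous (y x) (p x) s h)
    simp only [← intervalIntegral.integral_const_mul] at e
    refine (intervalIntegral.integral_congr fun t _ => ?_).trans
      (e.trans (intervalIntegral.integral_congr fun r _ => ?_))
    · simp [hτ]
      ring
    · simp [hτ]
      ring
  have h0 := M.mem_of_forall_integral_mem hM hγ fun s => by
    rw [hint]
    exact Submodule.intervalIntegral_mem hM (hδ s) (fun r => M.sub_mem (hu s r) (hu 0 r)) 0 h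
  convert h0 using 1
  ext x
  simp [hτ, mul_sub, mul_assoc]

/-- Each factor of `q` costs one forward difference. The order `k` depends on `q` alone, which
leaves `h`, `w` and `c` free. -/
theorem mul_fwdDiff_iter_mem {M : Submodule ℝ C(K, ℝ)} (hM : IsClosed (M : Set C(K, ℝ)))
    {V : Submodule ℝ C(K, ℝ)} {σ : ℝ → ℝ} (hσ : Continuous σ)
    (hMV : ∀ w ∈ V, ∀ c : ℝ, ∃ f ∈ M, ∀ x, f x = σ (w x + c)) {q : C(K, ℝ)}
    (hq : q ∈ Submonoid.closure (V : Set C(K, ℝ))) :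
    ∃ k : ℕ, ∀ h : ℝ, ∀ w ∈ V, ∀ c : ℝ, ∃ f ∈ M, ∀ x, f x = q x * (fwdDiff h)^[k] σ (w x + c) := by
  induction hq using Submonoid.closure_induction_left with
  | one => exact ⟨0, fun h w hw c => by simpa using hMV w hw c⟩
  | mul_left p hp q hq ih =>
    obtain ⟨k, hk⟩ := ih
    refine ⟨k + 1, fun h w hw c => ?_⟩
    have hcont : Continuous ((fwdDiff h)^[k] σ) := by
      have : (fwdDiff h)^[k] σ = fun y => _ := funext fun y => fwdDiff_iter_eq_sum_shift h σ k y
      rw [this]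
      fun_prop
    -- The shift `s • p` is absorbed by `w`, as `V` is a subspace, and the shift `r` by `c`.
    have hmem := mul_fwdDiff_mem hM q p (w + ContinuousMap.const K c) ⟨_, hcont⟩ (fun s r => by
      obtain ⟨f, hf, hfx⟩ := hk h (w + s • p) (V.add_mem hw (V.smul_mem s hp)) (c + r)
      convert hf using 1
      ext x
      rw [hfx]
      simp only [ContinuousMap.mul_apply, ContinuousMap.comp_apply, ContinuousMap.coe_mk,
        ContinuousMap.add_apply, ContinuousMap.smul_apply, ContinuousMap.const_apply]
      congr 2
      ring_nf) h
    refine ⟨_, hmem, fun x => ?_⟩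
    rw [Function.iterate_succ_apply', fwdDiff]
    rfl

/-- A closed space of functions on a compact space which contains all `σ(w + c)`, for `w` in a
point-separating space of functions and `σ` not a polynomial, contains all continuous functions. -/
theorem eq_top_of_ridge_mem {M : Submodule ℝ C(K, ℝ)} (hM : IsClosed (M : Set C(K, ℝ)))
    {V : Submodule ℝ C(K, ℝ)} (hV : ∀ x y : K, x ≠ y → ∃ w ∈ V, w x ≠ w y)
    {σ : ℝ → ℝ} (hσ : Continuous σ) (hpoly : ¬ ∃ p : Polynomial ℝ, ∀ x, σ x = p.eval x)
    (hMV : ∀ w ∈ V, ∀ c : ℝ, ∃ f ∈ M, ∀ x, f x = σ (w x + c)) : M = ⊤ := by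
  have hsub : Subalgebra.toSubmodule (Algebra.adjoin ℝ (V : Set C(K, ℝ))) ≤ M := by
    rw [Algebra.adjoin_eq_span, Submodule.span_le]
    intro q hq
    obtain ⟨k, hk⟩ := mul_fwdDiff_iter_mem hM hσ hMV hq
    obtain ⟨h, c, hc⟩ : ∃ h c, (fwdDiff h)^[k] σ c ≠ 0 := by
      by_contra! hcon
      exact hpoly (hσ.exists_polynomial_of_fwdDiff_iter_eq_zero hcon)
    obtain ⟨f, hf, hfx⟩ := hk h 0 V.zero_mem c
    have hqf : q = ((fwdDiff h)^[k] σ c)⁻¹ • f := by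
      ext x
      simp [hfx, hc, mul_comm]
    rw [hqf]
    exact M.smul_mem _ hf
  have hsep : (Algebra.adjoin ℝ (V : Set C(K, ℝ))).SeparatesPoints := fun x y hxy => by
    obtain ⟨w, hw, hne⟩ := hV x y hxy
    exact ⟨w, ⟨w, Algebra.subset_adjoin hw, rfl⟩, hne⟩
  have hSW := ContinuousMap.subalgebra_topologicalClosure_eq_top_of_separatesPoints _ hsep
  rw [eq_top_iff]
  intro f _
  have hf : f ∈ (Algebra.adjoin ℝ (V : Set C(K, ℝ))).topologicalClosure := by
    rw [hSW]
    exact Algebra.mem_top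
  exact closure_minimal hsub hM hf

end RidgeFunctions

/-! ### Universal approximation with one hidden layer -/

/-- The ridge functions `x ↦ σ(w x) • v`. -/
def ridgeFunctions (σ : ℝ → ℝ) (m n : ℕ) : Set C(Euc m, Euc n) :=
  {f | ∃ (w : Euc m →ᵃ[ℝ] ℝ) (v : Euc n), ∀ x, f x = σ (w x) • v}

theorem span_ridgeFunctions_subset (σ : ℝ → ℝ) (m n : ℕ) :
    (Submodule.span ℝ (ridgeFunctions σ m n) : Set C(Euc m, Euc n)) ⊆ NNDepth σ 1 m n := by
  intro f hf
  obtain ⟨k, c, g, rfl⟩ := Submodule.mem_span_set'.1 hf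
  choose w v hg using fun j => (g j).2
  refine ⟨k, (EuclideanSpace.equiv (Fin k) ℝ).symm.toLinearEquiv.toLinearMap.toAffineMap.comp
    (AffineMap.pi w), _,
    ⟨(∑ j, (EuclideanSpace.proj j : Euc k →L[ℝ] ℝ).toLinearMap.smulRight
      (c j • v j)).toAffineMap, rfl⟩, ?_⟩
  ext1 x
  simp [compwise, hg, smul_comm (c _)]

theorem uccDense_NNDepth_one {σ : ℝ → ℝ} (hσ : Continuous σ)
    (hpoly : ¬ ∃ p : Polynomial ℝ, ∀ x, σ x = p.eval x) (m n : ℕ) :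
    UccDense dist (NNDepth σ 1 m n) := by
  intro g K hK ε hε
  have : CompactSpace K := isCompact_iff_compactSpace.1 hK
  let R : C(Euc m, Euc n) →ₗ[ℝ] C(K, Euc n) :=
    { toFun := fun f => f.restrict K
      map_add' := fun _ _ => rfl
      map_smul' := fun _ _ => rfl }
  let N := ((Submodule.span ℝ (ridgeFunctions σ m n)).map R).topologicalClosure
  let T : Euc n → C(K, ℝ) →L[ℝ] C(K, Euc n) := fun v =>
    (ContinuousLinearMap.toSpanSingleton ℝ v).compLeftContinuous ℝ K
  let Λ : (Euc m →L[ℝ] ℝ) →ₗ[ℝ] C(K, ℝ) :=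
    { toFun := fun w => (w : C(Euc m, ℝ)).restrict K
      map_add' := fun _ _ => rfl
      map_smul' := fun _ _ => rfl }
  -- Reduction to scalar targets: for fixed `v`, the scalar functions `f` with `f • v ∈ N` form a
  -- closed space to which the ridge criterion applies.
  have htop : ∀ v, N.comap (T v).toLinearMap = ⊤ := by
    intro v
    refine eq_top_of_ridge_mem (V := LinearMap.range Λ)
      ((Submodule.isClosed_topologicalClosure _).preimage (T v).continuous) ?_ hσ hpoly ?_
    · intro x y hxy
      obtain ⟨i, hi⟩ : ∃ i, (x : Euc m) i ≠ (y : Euc m) i := by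
        by_contra! hcon
        exact hxy (Subtype.ext (PiLp.ext hcon))
      exact ⟨_, ⟨EuclideanSpace.proj i, rfl⟩, hi⟩
    · rintro _ ⟨w, rfl⟩ c
      refine ⟨⟨fun x => σ (w x + c), by fun_prop⟩, ?_, fun x => rfl⟩
      refine Submodule.le_topologicalClosure _ ⟨⟨fun x => σ (w x + c) • v, by fun_prop⟩,
        Submodule.subset_span ⟨w.toLinearMap.toAffineMap + AffineMap.const ℝ _ c, v,
          fun x => rfl⟩, rfl⟩
  have hg : R g = ∑ i, T (EuclideanSpace.single i 1)
      ⟨fun x => g x i, by fun_prop⟩ := by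
    ext x i
    simp [T, ContinuousMap.sum_apply, Pi.single_apply]
    rfl
  have hgN : R g ∈ N := by
    rw [hg]
    refine N.sum_mem fun i _ => ?_
    have := htop (EuclideanSpace.single i 1)
    rw [Submodule.eq_top_iff'] at this
    exact this _
  obtain ⟨_, ⟨f, hf, rfl⟩, hd⟩ := Metric.mem_closure_iff.1 hgN ε hε
  refine ⟨f, span_ridgeFunctions_subset σ m n hf, fun x hx => ?_⟩
  exact (ContinuousMap.dist_apply_le_dist (f := R g) (g := R f) ⟨x, hx⟩).trans_lt hd

/-! ### Ucc-density, compact-open density and lifting -/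

theorem UccDense.dense {X Y : Type*} [TopologicalSpace X] [PseudoMetricSpace Y] {S : Set C(X, Y)}
    (hS : UccDense dist S) : Dense S := by
  intro g
  rw [mem_closure_iff_frequently, Filter.frequently_iff]
  intro U hU
  obtain ⟨⟨K, ε⟩, ⟨hK, hε⟩, hsub⟩ :=
    (nhds_basis_uniformity' Metric.uniformity_basis_dist.compactConvergenceUniformity).mem_iff.1 hU
  obtain ⟨h, hh, hd⟩ := hS g K hK ε hε
  exact ⟨h, hsub fun x hx => hd x hx, hh⟩

/-- The map `h ↦ δ(g, h)` is continuous for the compact-open topologies, so the condition on `h` is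
open, and `g` satisfies it. Neither the triangle inequality nor compatibility of `δ` with the
uniformity is needed. -/
theorem Dense.uccDense {X Y : Type*} [TopologicalSpace X] [UniformSpace Y] {S : Set C(X, Y)}
    (hS : Dense S) {δ : Y → Y → ℝ} (hδ : Continuous fun p : Y × Y => δ p.1 p.2)
    (hδ0 : ∀ y, δ y y = 0) : UccDense δ S := by
  intro g K hK ε hε
  let Φ : C(X, Y) → C(X, ℝ) := fun h => (⟨_, hδ⟩ : C(Y × Y, ℝ)).comp (g.prodMk h)
  have hΦ : Continuous Φ := by
    refine (ContinuousMap.continuous_postcomp _).comp (continuous_iff_continuousAt.2 fun f => ?_)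
    refine ContinuousMap.tendsto_iff_forall_isCompact_tendstoUniformlyOn.2 fun L hL => ?_
    have hf := ContinuousMap.tendsto_iff_forall_isCompact_tendstoUniformlyOn.1
      (Filter.tendsto_id (x := nhds f)) L hL
    have hg := ContinuousMap.tendsto_iff_forall_isCompact_tendstoUniformlyOn.1
      (tendsto_const_nhds (x := g) (f := nhds f)) L hL
    exact fun u hu =>
      (Filter.tendsto_id.prodMk Filter.tendsto_id).eventually (hg.prodMk hf u hu)
  have hU : IsOpen (Φ ⁻¹' {u | Set.MapsTo u K (Set.Iio ε)}) :=
    (ContinuousMap.isOpen_setOfPred_mapsTo hK isOpen_Iio).preimage hΦ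
  obtain ⟨h, hh, hS⟩ := hS.inter_open_nonempty _ hU
    ⟨g, fun x _ => by simpa [Φ, hδ0] using hε⟩
  exact ⟨h, hS, fun x hx => hh hx⟩

/-- If the feature map has a continuous left inverse and the readout map has a continuous right
inverse, a dense architecture lifts to a dense architecture. -/
theorem Dense.liftArch {X E E' Y : Type*} [TopologicalSpace X] [TopologicalSpace E]
    [TopologicalSpace E'] [TopologicalSpace Y] {φ : X → E} {ρ : E' → Y} {φ' : E → X} {ρ' : Y → E'}
    (hφ : Continuous φ) (hρ : Continuous ρ) (hφ' : Continuous φ') (hρ' : Continuous ρ')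
    (hφφ' : Function.LeftInverse φ' φ) (hρρ' : Function.RightInverse ρ' ρ) {F : Set C(E, E')}
    (hF : Dense F) : Dense (liftArch φ ρ F) := by
  let T : C(E, E') → C(X, Y) := fun f => (⟨ρ, hρ⟩ : C(E', Y)).comp (f.comp ⟨φ, hφ⟩)
  have hT : Continuous T :=
    (ContinuousMap.continuous_postcomp _).comp (ContinuousMap.continuous_precomp _)
  have hsurj : Function.Surjective T := fun g =>
    ⟨(⟨ρ', hρ'⟩ : C(Y, E')).comp (g.comp ⟨φ', hφ'⟩), by
      ext x
      simp [T, hφφ' x, hρρ' (g x)]⟩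
  refine (hsurj.denseRange.dense_image hT hF).mono ?_
  rintro _ ⟨f, hf, rfl⟩
  exact ⟨f, hf, fun x => rfl⟩

/-! ### Continuity and inversion of `Log` and `Exp` -/

theorem continuous_spdSqrt {d : ℕ} : Continuous (spdSqrt (d := d)) := by
  open scoped MatrixOrder Matrix.Norms.L2Operator in
  exact CFC.continuousOn_sqrt.comp_continuous continuous_subtype_val
    fun A => A.2.posSemidef.nonneg

theorem continuous_spdSqrt_inv {d : ℕ} : Continuous fun A : SPD d => (spdSqrt A)⁻¹ := by
  simp only [Matrix.inv_def, Ring.inverse_eq_inv']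
  exact (Continuous.inv₀ continuous_spdSqrt.matrix_det fun A => (spdSqrt_posDef A).det_pos.ne').smul
    continuous_spdSqrt.matrix_adjugate

theorem posDef_spdSqrt_inv_mul_mul {d : ℕ} (A C : SPD d) :
    ((spdSqrt A)⁻¹ * C.1 * (spdSqrt A)⁻¹).PosDef := by
  have hS := (spdSqrt_posDef A).inv
  have h := (Matrix.IsUnit.posDef_star_right_conjugate_iff hS.isUnit).2 C.2
  rwa [Matrix.star_eq_conjTranspose, hS.1.eq] at h

theorem continuous_relLog {d : ℕ} : Continuous fun p : SPD d × SPD d => relLog p.1 p.2 := by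
  open scoped MatrixOrder Matrix.Norms.L2Operator in
  refine CFC.continuousOn_log.comp_continuous (f := fun p : SPD d × SPD d =>
    (spdSqrt p.1)⁻¹ * p.2.1 * (spdSqrt p.1)⁻¹) ?_ fun p =>
    ⟨(posDef_spdSqrt_inv_mul_mul p.1 p.2).1, (posDef_spdSqrt_inv_mul_mul p.1 p.2).isUnit⟩
  have h1 : Continuous fun p : SPD d × SPD d => (spdSqrt p.1)⁻¹ :=
    continuous_spdSqrt_inv.comp continuous_fst
  exact (h1.mul (continuous_subtype_val.comp continuous_snd)).mul h1

theorem continuous_spdLog {d : ℕ} (A : SPD d) : Continuous (spdLog A) := by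
  refine Continuous.subtype_mk ?_ _
  exact (continuous_const.mul (continuous_relLog.comp (Continuous.prodMk_right A))).mul
    continuous_const

theorem continuous_spdExp {d : ℕ} (B : SPD d) : Continuous (spdExp B) := by
  refine Continuous.subtype_mk ?_ _
  have h : Continuous (NormedSpace.exp : Matrix (Fin d) (Fin d) ℝ → _) := by
    open scoped Matrix.Norms.L2Operator in
    let _ : NormedAlgebra ℚ (Matrix (Fin d) (Fin d) ℝ) := NormedAlgebra.restrictScalars ℚ ℝ _
    exact NormedSpace.exp_continuous
  exact (continuous_const.mul (h.comp ((continuous_const.mul continuous_subtype_val).mul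
    continuous_const))).mul continuous_const

theorem exp_relLog {d : ℕ} (A C : SPD d) :
    NormedSpace.exp (relLog A C) = (spdSqrt A)⁻¹ * C.1 * (spdSqrt A)⁻¹ := by
  open scoped MatrixOrder Matrix.Norms.L2Operator in
  exact CFC.exp_log _ (posDef_spdSqrt_inv_mul_mul A C).isStrictlyPositive

/-- This one-sided identity suffices: at `A` it gives the left inverse of the feature map, at `B`
the right inverse of the readout. -/
theorem spdExp_spdLog {d : ℕ} (A C : SPD d) : spdExp A (spdLog A C) = C := by
  have hu := (Matrix.isUnit_iff_isUnit_det _).1 (spdSqrt_posDef A).isUnit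
  apply Subtype.ext
  have h : (spdSqrt A)⁻¹ * (spdSqrt A * relLog A C * spdSqrt A) * (spdSqrt A)⁻¹ = relLog A C := by
    rw [Matrix.mul_assoc (spdSqrt A), Matrix.nonsing_inv_mul_cancel_left _ _ hu,
      Matrix.mul_nonsing_inv_cancel_right _ _ hu]
  change spdSqrt A * NormedSpace.exp ((spdSqrt A)⁻¹ * (spdSqrt A * relLog A C * spdSqrt A) *
    (spdSqrt A)⁻¹) * spdSqrt A = C.1
  rw [h, exp_relLog, Matrix.mul_assoc, Matrix.nonsing_inv_mul_cancel_right _ _ hu,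
    Matrix.mul_nonsing_inv_cancel_left _ _ hu]

theorem continuous_spdDist {d : ℕ} : Continuous fun p : SPD d × SPD d => spdDist p.1 p.2 := by
  refine Real.continuous_sqrt.comp (continuous_finsetSum _ fun i _ => continuous_finsetSum _
    fun j _ => (continuous_relLog.matrix_elem i j).pow 2)

theorem spdSqrt_inv_mul_mul_self {d : ℕ} (A : SPD d) :
    (spdSqrt A)⁻¹ * A.1 * (spdSqrt A)⁻¹ = 1 := by
  have hu := (Matrix.isUnit_iff_isUnit_det _).1 (spdSqrt_posDef A).isUnit
  have hsq : spdSqrt A * spdSqrt A = A.1 := by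
    open scoped MatrixOrder in exact CFC.sqrt_mul_sqrt_self A.1 A.2.posSemidef.nonneg
  rw [← hsq, Matrix.nonsing_inv_mul_cancel_left _ _ hu, Matrix.mul_nonsing_inv _ hu]

theorem spdDist_self {d : ℕ} (A : SPD d) : spdDist A A = 0 := by
  have h : relLog A A = 0 := by
    open scoped Matrix.Norms.L2Operator in
    rw [relLog, spdSqrt_inv_mul_mul_self]
    exact CFC.log_one
  simp [spdDist, h]

theorem Dense.spdArch {d D : ℕ} (a : SymMat d ≃ₗ[ℝ] Euc (d * (d + 1) / 2))
    (b : SymMat D ≃ₗ[ℝ] Euc (D * (D + 1) / 2)) (A : SPD d) (B : SPD D)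
    {F : Set C(Euc (d * (d + 1) / 2), Euc (D * (D + 1) / 2))} (hF : Dense F) :
    Dense (spdArch a b A B F) := by
  have : FiniteDimensional ℝ (SymMat d) := inferInstance
  have : FiniteDimensional ℝ (SymMat D) := inferInstance
  have ha : Continuous a := a.toLinearMap.continuous_of_finiteDimensional
  have ha' : Continuous a.symm := a.symm.toLinearMap.continuous_of_finiteDimensional
  have hb : Continuous b := b.toLinearMap.continuous_of_finiteDimensional
  have hb' : Continuous b.symm := b.symm.toLinearMap.continuous_of_finiteDimensional
  exact hF.liftArch (φ' := fun v => spdExp A (a.symm v)) (ρ' := fun C => b (spdLog B C))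
    (ha.comp (continuous_spdLog A)) ((continuous_spdExp B).comp hb')
    ((continuous_spdExp A).comp ha') (hb.comp (continuous_spdLog B))
    (fun C => by simp [spdExp_spdLog]) (fun C => by simp [spdExp_spdLog])

theorem mainTheorem6 (d D : ℕ) (hd : 0 < d) (hD : 0 < D)
    (a : SymMat d ≃ₗ[ℝ] Euc (d * (d + 1) / 2)) (b : SymMat D ≃ₗ[ℝ] Euc (D * (D + 1) / 2))
    (A : SPD d) (B : SPD D) :
    (∀ F : Set C(Euc (d * (d + 1) / 2), Euc (D * (D + 1) / 2)), UccDense dist F →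
      UccDense spdDist (spdArch a b A B F) ∧ Dense (spdArch a b A B F)) ∧
    (∀ σ : ℝ → ℝ, Continuous σ → (¬ ∃ p : Polynomial ℝ, ∀ x, σ x = p.eval x) →
      (UccDense spdDist (spdArch a b A B (NNDepth σ 1 _ _)) ∧
        Dense (spdArch a b A B (NNDepth σ 1 _ _))) ∧
      (UccDense spdDist (spdArch a b A B (NN σ _ _)) ∧
        Dense (spdArch a b A B (NN σ _ _)))) := by
  have key : ∀ F : Set C(Euc (d * (d + 1) / 2), Euc (D * (D + 1) / 2)), UccDense dist F →
      UccDense spdDist (spdArch a b A B F) ∧ Dense (spdArch a b A B F) := fun F hF => by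
    have h := hF.dense.spdArch a b A B
    exact ⟨h.uccDense continuous_spdDist spdDist_self, h⟩
  refine ⟨key, fun σ hσ hpoly => ?_⟩
  have h := uccDense_NNDepth_one hσ hpoly (d * (d + 1) / 2) (D * (D + 1) / 2)
  refine ⟨key _ h, key _ fun g K hK ε hε => ?_⟩
  obtain ⟨f, hf, hd⟩ := h g K hK ε hε
  exact ⟨f, ⟨1, le_rfl, hf⟩, hd⟩
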